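/- Let $p$ be an odd prime and let $x\in\mathbb{Z}_p$ be a $p$-adic integer. Let $\langle x\rangle_p\in\{0,1,\dots,p-1\}$ denote the least nonnegative residue of $x$ modulo $p$, and write $x=\langle x\rangle_p+pt$ with $t\in\mathbb{Z}_p$. Then $$ (2x+1)\sum_{k=0}^{p-1}\frac{\binom{x}{k}\binom{x+k}{k}(-4)^k}{(2k+1)\binom{2k}{k}}\equiv(-1)^{\langle x\rangle_p}(2t+1)-2pt(t+1)E_{p-2}(-x)\pmod{p^2}, $$ where $\binom{y}{k}=y(y-1)\cdots(y-k+1)/k!$ for $y\in\mathbb{Z}_p$, and where the Euler polynomials $E_n(X)\in\mathbb{Q}[X]$ are defined by $\frac{2e^{Xz}}{e^z+1}=\sum_{n=0}^{\infty}E_n(X)\frac{z^n}{n!}$. The congruence means that the difference of the two sides, computed in $\mathbb{Q}_p$, lies in $p^2\mathbb{Z}_p$. -/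

import Mathlib

/-- The `n`-th Euler polynomial `E_n`, with rational coefficients, defined by the generating function
`2 e^{xz} / (e^z + 1) = ∑ E_n(x) z^n / n!`, read as an identity of formal power series in `z` over
`ℚ[x]`: the factor `2 / (e^z + 1)` is a power series over `ℚ`, and `e^{xz}` is the series
`∑ x^n z^n / n!`. -/
noncomputable def eulerPolynomial (n : ℕ) : Polynomial ℚ :=
  (n.factorial : ℚ) • PowerSeries.coeff n
    (PowerSeries.map Polynomial.C (2 * (PowerSeries.exp ℚ + 1)⁻¹) *
      PowerSeries.rescale Polynomial.X (PowerSeries.exp (Polynomial ℚ)))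

/-- The inverse in the definition is a genuine one:
`(∑ E_n(x) z^n / n!) (e^z + 1) = 2 e^{xz}`. -/
theorem eulerPolynomial_generating_function :
    PowerSeries.mk (fun n => ((n.factorial : ℚ)⁻¹) • eulerPolynomial n) *
        (PowerSeries.exp (Polynomial ℚ) + 1) =
      2 * PowerSeries.rescale Polynomial.X (PowerSeries.exp (Polynomial ℚ)) := by
  have h1 : PowerSeries.mk (fun n => ((n.factorial : ℚ)⁻¹) • eulerPolynomial n) =
      PowerSeries.map Polynomial.C (2 * (PowerSeries.exp ℚ + 1)⁻¹) *
        PowerSeries.rescale Polynomial.X (PowerSeries.exp (Polynomial ℚ)) := by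
    ext1 n
    rw [PowerSeries.coeff_mk, eulerPolynomial, smul_smul, inv_mul_cancel₀, one_smul]
    exact_mod_cast n.factorial_ne_zero
  have h2 : (PowerSeries.exp (Polynomial ℚ) + 1) =
      PowerSeries.map Polynomial.C (PowerSeries.exp ℚ + 1) := by
    rw [map_add, map_one, PowerSeries.map_exp]
  have h3 : (PowerSeries.exp ℚ + 1)⁻¹ * (PowerSeries.exp ℚ + 1) = 1 := by
    apply PowerSeries.inv_mul_cancel
    simp only [map_add, map_one, PowerSeries.constantCoeff_exp]
    norm_num
  rw [h1, h2, mul_right_comm, ← map_mul, mul_assoc, h3, mul_one, map_ofNat]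

/-! Let `S(x)` be the left side (`sineSum p`), with `x = r + pt`. Fix `t` and vary `r`: both sides
satisfy the same first-order recurrence mod `p^2`, and they agree at one point. The sum `S(x) +
S(x-1)` has a closed product form (`sineSum_add_sineSum_sub_one`), which for `r ≠ 0` is
`4pt(t+1)x^(p-2)` mod `p^2` by Wilson and Fermat. The right side matches because `E(X+1) + E(X) =
2X^(p-2)` and `p-2` is odd. The anchor is `r = (p-1)/2`, where `x ≡ -1/2` mod `p`: there `2x+1`
supplies a factor `p`, the summands are symmetric about `-1/2`, and `E_{p-2}(-x) ≡ E_{p-2}(1/2) ≡ 0`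
mod `p`. -/

/-! ### Euler polynomials: functional equation and `p`-integrality -/

open Polynomial in
/-- The defining recurrence of the Euler polynomials. -/
theorem sum_choose_smul_eulerPolynomial (n : ℕ) :
    ∑ k ∈ Finset.range (n + 1), (n.choose k : ℚ[X]) * eulerPolynomial k + eulerPolynomial n =
      2 * X ^ n := by
  have h := congrArg (PowerSeries.coeff n) eulerPolynomial_generating_function
  have hn : (n.factorial : ℚ) ≠ 0 := by exact_mod_cast n.factorial_ne_zero
  rw [mul_add, mul_one, map_add, PowerSeries.coeff_mul,
    Finset.Nat.sum_antidiagonal_eq_sum_range_succ_mk,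
    show (2 : PowerSeries ℚ[X]) = PowerSeries.C (2 : ℚ[X]) from (map_ofNat _ 2).symm,
    PowerSeries.coeff_C_mul, PowerSeries.coeff_rescale] at h
  simp only [PowerSeries.coeff_mk, PowerSeries.coeff_exp] at h
  have h' := congrArg (fun q : ℚ[X] => C (n.factorial : ℚ) * q) h
  simp only [mul_add, Finset.mul_sum] at h'
  convert h' using 1
  · congr 1
    · refine Finset.sum_congr rfl fun k hk => ?_
      have hk' : k ≤ n := by simpa [Nat.lt_succ_iff] using hk
      have : (n.choose k : ℚ[X]) = C ((n.factorial : ℚ) * (k.factorial : ℚ)⁻¹ *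
          (1 / ((n - k).factorial : ℚ))) := by
        rw [← map_natCast (C : ℚ →+* ℚ[X]), Nat.cast_choose ℚ hk']
        congr 1
        field_simp
      rw [this, smul_eq_C_mul, C_mul, C_mul]
      simp only [algebraMap_eq]
      ring
    · rw [smul_eq_C_mul, ← mul_assoc, ← C_mul, mul_inv_cancel₀ hn, C_1, one_mul]
  · have : (C (n.factorial : ℚ) : ℚ[X]) * C (1 / (n.factorial : ℚ)) = 1 := by
      rw [← C_mul, mul_one_div_cancel hn, C_1]
    simp only [algebraMap_eq]
    linear_combination (-2 * X ^ n) * this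

-- Adding the recurrence to its shift by 1, the lower terms collapse by induction and the binomial
-- theorem, leaving twice the claim.
open Polynomial in
theorem eulerPolynomial_comp_X_add_one (n : ℕ) :
    (eulerPolynomial n).comp (X + 1) + eulerPolynomial n = 2 * X ^ n := by
  induction n using Nat.strong_induction_on with
  | _ n ih =>
    have h1 := sum_choose_smul_eulerPolynomial n
    have h2 := congrArg (fun q => q.comp (X + 1 : ℚ[X])) h1
    simp only [add_comp, sum_comp, mul_comp, natCast_comp, pow_comp, X_comp,
      ofNat_comp, Nat.cast_ofNat] at h2
    rw [Finset.sum_range_succ] at h1 h2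
    have h3 : ∑ k ∈ Finset.range n, (n.choose k : ℚ[X]) * (eulerPolynomial k).comp (X + 1) +
        ∑ k ∈ Finset.range n, (n.choose k : ℚ[X]) * eulerPolynomial k =
        2 * ∑ k ∈ Finset.range n, (X : ℚ[X]) ^ k * 1 ^ (n - k) * (n.choose k : ℚ[X]) := by
      rw [← Finset.sum_add_distrib, Finset.mul_sum]
      refine Finset.sum_congr rfl fun k hk => ?_
      rw [← mul_add, ih k (Finset.mem_range.1 hk)]
      ring
    have h4 := add_pow (X : ℚ[X]) 1 n
    rw [Finset.sum_range_succ] at h4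
    simp only [Nat.choose_self, Nat.cast_one, one_mul, mul_one, Nat.sub_self, pow_zero] at h1 h2 h4
    have h5 : (2 : ℚ[X]) * ((eulerPolynomial n).comp (X + 1) + eulerPolynomial n - 2 * X ^ n) = 0 := by
      simp only [one_pow, mul_one] at h3 h4
      linear_combination h1 + h2 - h3 + 2 * h4
    have h6 := (mul_eq_zero.1 h5).resolve_left two_ne_zero
    exact sub_eq_zero.1 h6

theorem PadicInt.isUnit_two {p : ℕ} [Fact p.Prime] (hp : p ≠ 2) : IsUnit (2 : ℤ_[p]) := by
  rw [PadicInt.isUnit_iff]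
  have := (PadicInt.norm_natCast_eq_one_iff (p := p) (n := 2)).2
    ((Nat.coprime_primes Fact.out Nat.prime_two).2 hp)
  simpa using this

-- The recurrence solves for `E_n` with no division except by 2, a unit for odd `p`.
open Polynomial in
theorem exists_padicInt_map_eq_eulerPolynomial {p : ℕ} [Fact p.Prime] (hp : p ≠ 2) (n : ℕ) :
    ∃ q : ℤ_[p][X], q.map PadicInt.Coe.ringHom = (eulerPolynomial n).map (algebraMap ℚ ℚ_[p]) := by
  induction n using Nat.strong_induction_on with
  | _ n ih =>
    choose! q hq using ih
    obtain ⟨u, hu⟩ := (PadicInt.isUnit_two hp).exists_right_inv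
    have hu' : (2 : ℚ_[p]) * (u : ℚ_[p]) = 1 := by
      exact_mod_cast congrArg (fun z : ℤ_[p] => (z : ℚ_[p])) hu
    have huC : (2 : ℚ_[p][X]) * C (u : ℚ_[p]) = 1 := by
      rw [← map_ofNat (C : ℚ_[p] →+* ℚ_[p][X]) 2, ← C_mul, hu', C_1]
    refine ⟨C u * (2 * X ^ n - ∑ k ∈ Finset.range n, (n.choose k : ℤ_[p][X]) * q k), ?_⟩
    have h := congrArg (Polynomial.map (algebraMap ℚ ℚ_[p])) (sum_choose_smul_eulerPolynomial n)
    rw [Finset.sum_range_succ] at h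
    simp only [Polynomial.map_add, Polynomial.map_sum, Polynomial.map_mul, Polynomial.map_natCast,
      Polynomial.map_ofNat, Polynomial.map_pow, map_X, Nat.choose_self, Nat.cast_one,
      one_mul] at h
    have hs : ∑ k ∈ Finset.range n, (n.choose k : ℚ_[p][X]) * (q k).map PadicInt.Coe.ringHom =
        ∑ k ∈ Finset.range n, (n.choose k : ℚ_[p][X]) *
          (eulerPolynomial k).map (algebraMap ℚ ℚ_[p]) :=
      Finset.sum_congr rfl fun k hk => by rw [hq k (Finset.mem_range.1 hk)]
    simp only [Polynomial.map_sub, Polynomial.map_sum, Polynomial.map_mul, Polynomial.map_natCast,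
      Polynomial.map_ofNat, Polynomial.map_pow, map_X, map_C, hs]
    change C (u : ℚ_[p]) * _ = _
    linear_combination (-C (u : ℚ_[p])) * h +
      (eulerPolynomial n).map (algebraMap ℚ ℚ_[p]) * huC

open Polynomial in
/-- An integral model over `ℤ_[p]` of the Euler polynomial `E_n`. -/
theorem exists_padicInt_eulerPolynomial {p : ℕ} [Fact p.Prime] (hp : p ≠ 2) (n : ℕ) :
    ∃ q : ℤ_[p][X], q.comp (X + 1) + q = 2 * X ^ n ∧
      ∀ z : ℤ_[p], aeval (z : ℚ_[p]) (eulerPolynomial n) = ((q.eval z : ℤ_[p]) : ℚ_[p]) := by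
  obtain ⟨q, hq⟩ := exists_padicInt_map_eq_eulerPolynomial hp n
  refine ⟨q, ?_, fun z => ?_⟩
  · have hinj : Function.Injective (PadicInt.Coe.ringHom : ℤ_[p] →+* ℚ_[p]) :=
      Subtype.coe_injective
    apply Polynomial.map_injective _ hinj
    have h := congrArg (Polynomial.map (algebraMap ℚ ℚ_[p])) (eulerPolynomial_comp_X_add_one n)
    simpa [Polynomial.map_comp, hq] using h
  · rw [aeval_def, ← eval_map, ← hq, eval_map]
    exact eval₂_at_apply PadicInt.Coe.ringHom z

open Polynomial in
/-- For odd `n`, a solution of `q(X+1) + q(X) = 2X^n` modulo `p` vanishes at `1/2`. -/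
theorem eval_eq_zero_of_comp_X_add_one {p : ℕ} [Fact p.Prime] (hp : p ≠ 2) {n : ℕ} (hn : Odd n)
    {q : (ZMod p)[X]} (hq : q.comp (X + 1) + q = 2 * X ^ n) {y : ZMod p} (hy : 2 * y = 1) :
    q.eval y = 0 := by
  have hp2 : (2 : ZMod p) ≠ 0 := Ring.two_ne_zero (by rwa [ZMod.ringChar_zmod_n])
  have he (z : ZMod p) : q.eval (z + 1) + q.eval z = 2 * z ^ n := by
    have := congrArg (eval z) hq
    simpa using this
  -- Oddness of `n` makes `q(z) + q(1-z)` change sign under `z ↦ z+1`. After `p` (odd) steps it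
  -- returns to itself negated; at `y = 1/2` it equals `2q(y)`.
  have hd (k : ℕ) : q.eval (y + k) + q.eval (1 - (y + k)) =
      (-1) ^ k * (q.eval y + q.eval (1 - y)) := by
    induction k with
    | zero => simp
    | succ k ih =>
      have h1 := he (y + k)
      have h2 := he (-(y + k))
      rw [hn.neg_pow] at h2
      rw [show 1 - (y + (k + 1 : ℕ)) = -(y + k) by push_cast; ring,
        show y + ((k + 1 : ℕ) : ZMod p) = y + k + 1 by push_cast; ring, pow_succ]
      rw [show -(y + (k : ZMod p)) + 1 = 1 - (y + k) by ring] at h2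
      linear_combination h1 + h2 - ih
  have h := hd p
  rw [CharP.cast_eq_zero, add_zero, ((Fact.out : p.Prime).odd_of_ne_two hp).neg_one_pow,
    show 1 - y = y by linear_combination -hy] at h
  have h4 : (2 * 2 : ZMod p) * q.eval y = 0 := by linear_combination h
  exact (mul_eq_zero.1 h4).resolve_left (mul_ne_zero hp2 hp2)

/-! ### The sum as a function of `x`: recurrence and values at integers -/

/-- The sum `(2x+1) ∑_{k<n} C(x,k) C(x+k,k) (-4)^k / ((2k+1) C(2k,k))` in product form. -/
noncomputable def sineSum {K : Type*} [Field K] (n : ℕ) (x : K) : K :=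
  (2 * x + 1) * ∑ k ∈ Finset.range n,
    (-4) ^ k * (∏ j ∈ Finset.range k, (x - j) * (x + j + 1)) / ((2 * k + 1).factorial : K)

theorem prod_sub_mul_add_one {R : Type*} [CommRing R] (x : R) (k : ℕ) :
    ∏ j ∈ Finset.range (k + 1), (x - j) * (x + j + 1) =
      x * (x + k + 1) * ∏ j ∈ Finset.range k, (x ^ 2 - (j + 1) ^ 2) := by
  induction k with
  | zero => simp
  | succ k ih =>
    rw [Finset.prod_range_succ, ih, Finset.prod_range_succ]
    push_cast
    ring

theorem prod_sub_one_sub_mul {R : Type*} [CommRing R] (x : R) (k : ℕ) :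
    ∏ j ∈ Finset.range (k + 1), (x - 1 - j) * (x - 1 + j + 1) =
      x * (x - k - 1) * ∏ j ∈ Finset.range k, (x ^ 2 - (j + 1) ^ 2) := by
  induction k with
  | zero => simp; ring
  | succ k ih =>
    rw [Finset.prod_range_succ, ih, Finset.prod_range_succ]
    push_cast
    ring

/-- The sum telescopes: adding the two terms of index `n+1` to the closed form for `n` gives the
closed form for `n+1`. -/
theorem sineSum_add_sineSum_sub_one {K : Type*} [Field K] [CharZero K] (n : ℕ) (x : K) :
    sineSum (n + 1) x + sineSum (n + 1) (x - 1) =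
      (-4) ^ n * (4 * x * ∏ j ∈ Finset.range n, (x ^ 2 - (j + 1) ^ 2)) /
        ((2 * n + 1).factorial : K) := by
  unfold sineSum
  induction n with
  | zero => simp; ring
  | succ n ih =>
    rw [Finset.sum_range_succ _ (n + 1), Finset.sum_range_succ _ (n + 1), mul_add (2 * x + 1),
      mul_add (2 * (x - 1) + 1), add_add_add_comm, ih, prod_sub_mul_add_one, prod_sub_one_sub_mul, Finset.prod_range_succ,
      show 2 * (n + 1) + 1 = (2 * n + 1) + 1 + 1 by ring, Nat.factorial_succ (2 * n + 1 + 1),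
      Nat.factorial_succ (2 * n + 1)]
    have h0 : ((2 * n + 1).factorial : K) ≠ 0 := by exact_mod_cast Nat.factorial_ne_zero _
    have h1 : (2 * (n : K) + 1 + 1) ≠ 0 := by exact_mod_cast Nat.succ_ne_zero (2 * n + 1)
    have h2 : (2 * (n : K) + 1 + 1 + 1) ≠ 0 := by exact_mod_cast Nat.succ_ne_zero (2 * n + 1 + 1)
    push_cast
    field_simp
    ring

/-- At `x = r+1` the product in the recurrence contains a zero factor, so the values alternate from
1 at `x = 0`. -/
theorem sineSum_natCast {K : Type*} [Field K] [CharZero K] {n r : ℕ} (hr : r < n) :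
    sineSum n (r : K) = (-1) ^ r := by
  obtain ⟨n, rfl⟩ : ∃ m, n = m + 1 := ⟨n - 1, by omega⟩
  induction r with
  | zero =>
    unfold sineSum
    rw [Finset.sum_range_succ', Finset.sum_eq_zero]
    · simp
    · intro k _
      rw [Finset.prod_range_succ']
      simp
  | succ r ih =>
    have h := sineSum_add_sineSum_sub_one n ((r + 1 : ℕ) : K)
    rw [Finset.prod_eq_zero (i := r) (Finset.mem_range.2 (by omega)) (by push_cast; ring),
      show ((r + 1 : ℕ) : K) - 1 = r by push_cast; ring, ih (by omega)] at h
    rw [pow_succ]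
    linear_combination h

theorem PadicInt.coe_finsetProd {p : ℕ} [Fact p.Prime] {ι : Type*} (s : Finset ι)
    (f : ι → ℤ_[p]) : ((∏ i ∈ s, f i : ℤ_[p]) : ℚ_[p]) = ∏ i ∈ s, (f i : ℚ_[p]) :=
  map_prod PadicInt.Coe.ringHom f s

@[norm_cast]
theorem PadicInt.coe_ofNat_eq_ofNat {p : ℕ} [Fact p.Prime] (n : ℕ) [n.AtLeastTwo] :
    ((ofNat(n) : ℤ_[p]) : ℚ_[p]) = ofNat(n) :=
  map_ofNat PadicInt.Coe.ringHom n

theorem factorial_mul_choose_eq_prod {p : ℕ} [Fact p.Prime] (x : ℤ_[p]) (k : ℕ) :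
    (k.factorial : ℤ_[p]) * Ring.choose x k = ∏ j ∈ Finset.range k, (x - j) := by
  rw [← nsmul_eq_mul, ← Ring.descPochhammer_eq_factorial_smul_choose, ← Polynomial.aeval_eq_smeval,
    Polynomial.aeval_def, ← Polynomial.eval_map, descPochhammer_map,
    descPochhammer_eval_eq_prod_range]

theorem factorial_mul_choose_add_eq_prod {p : ℕ} [Fact p.Prime] (x : ℤ_[p]) (k : ℕ) :
    (k.factorial : ℤ_[p]) * Ring.choose (x + k) k = ∏ j ∈ Finset.range k, (x + j + 1) := by
  rw [factorial_mul_choose_eq_prod, ← Finset.prod_range_reflect]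
  refine Finset.prod_congr rfl fun j hj => ?_
  have hj := Finset.mem_range.1 hj
  have : ((k - 1 - j : ℕ) : ℤ_[p]) = k - 1 - j := by
    rw [Nat.cast_sub (by omega), Nat.cast_sub (by omega), Nat.cast_one]
  rw [this]
  ring

theorem sum_choose_mul_choose_eq_sineSum {p : ℕ} [Fact p.Prime] (x : ℤ_[p]) (n : ℕ) :
    (2 * (x : ℚ_[p]) + 1) *
        ∑ k ∈ Finset.range n,
          ((Ring.choose x k : ℤ_[p]) : ℚ_[p]) * ((Ring.choose (x + (k : ℤ_[p])) k : ℤ_[p]) : ℚ_[p]) *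
              (-4 : ℚ_[p]) ^ k /
            ((2 * (k : ℚ_[p]) + 1) * (Nat.choose (2 * k) k : ℚ_[p])) =
      sineSum n (x : ℚ_[p]) := by
  unfold sineSum
  congr 1
  refine Finset.sum_congr rfl fun k _ => ?_
  have h1 : (k.factorial : ℚ_[p]) * ((Ring.choose x k : ℤ_[p]) : ℚ_[p]) =
      ∏ j ∈ Finset.range k, ((x : ℚ_[p]) - j) := by
    have h := congrArg (fun z : ℤ_[p] => (z : ℚ_[p])) (factorial_mul_choose_eq_prod x k)
    push_cast [PadicInt.coe_finsetProd] at h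
    exact h
  have h2 : (k.factorial : ℚ_[p]) * ((Ring.choose (x + (k : ℤ_[p])) k : ℤ_[p]) : ℚ_[p]) =
      ∏ j ∈ Finset.range k, ((x : ℚ_[p]) + j + 1) := by
    have h := congrArg (fun z : ℤ_[p] => (z : ℚ_[p])) (factorial_mul_choose_add_eq_prod x k)
    push_cast [PadicInt.coe_finsetProd] at h
    exact h
  have h3 : ((2 * k + 1).factorial : ℚ_[p]) =
      (2 * k + 1) * ((2 * k).choose k * (k.factorial * k.factorial)) := by
    have := Nat.choose_mul_factorial_mul_factorial (n := 2 * k) (k := k) (by omega)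
    rw [show 2 * k - k = k by omega] at this
    rw [Nat.factorial_succ, ← this]
    push_cast
    ring
  have hk : (k.factorial : ℚ_[p]) ≠ 0 := by exact_mod_cast k.factorial_ne_zero
  have hc : ((2 * k).choose k : ℚ_[p]) ≠ 0 := by
    exact_mod_cast (Nat.choose_pos (by omega : k ≤ 2 * k)).ne'
  have ho : (2 * (k : ℚ_[p]) + 1) ≠ 0 := by exact_mod_cast Nat.succ_ne_zero (2 * k)
  rw [Finset.prod_mul_distrib, ← h1, ← h2, h3]
  field_simp

/-! ### Wilson-type products and the factor `p` in factorials -/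

theorem PadicInt.toZMod_eq_zero_iff_dvd {p : ℕ} [Fact p.Prime] (z : ℤ_[p]) :
    PadicInt.toZMod z = 0 ↔ (p : ℤ_[p]) ∣ z := by
  rw [← RingHom.mem_ker, PadicInt.ker_toZMod, PadicInt.maximalIdeal_eq_span_p,
    Ideal.mem_span_singleton]

theorem PadicInt.exists_mul_eq_one_of_toZMod_ne_zero {p : ℕ} [Fact p.Prime] {z : ℤ_[p]}
    (hz : PadicInt.toZMod z ≠ 0) : ∃ y : ℤ_[p], z * y = 1 := by
  have h : IsUnit z := by
    rw [PadicInt.isUnit_iff]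
    by_contra h
    refine hz ((PadicInt.toZMod_eq_zero_iff_dvd z).2 ?_)
    exact (PadicInt.norm_lt_one_iff_dvd z).1 (lt_of_le_of_ne z.norm_le_one h)
  exact h.exists_right_inv

/-- By cardinality `g` enumerates the nonzero residues, so this is Wilson's theorem. -/
theorem ZMod.prod_eq_neg_one_of_injOn {p : ℕ} [Fact p.Prime] {s : Finset ℕ} {g : ℕ → ZMod p}
    (hs : s.card = p - 1) (hinj : Set.InjOn g s) (h0 : ∀ j ∈ s, g j ≠ 0) :
    ∏ j ∈ s, g j = -1 := by
  have key {s : Finset ℕ} {g : ℕ → ZMod p} (hs : s.card = p - 1) (hinj : Set.InjOn g s)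
      (h0 : ∀ j ∈ s, g j ≠ 0) : ∏ j ∈ s, g j = ∏ a ∈ Finset.univ.erase (0 : ZMod p), a := by
    have : s.image g = Finset.univ.erase (0 : ZMod p) := by
      apply Finset.eq_of_subset_of_card_le
      · intro a ha
        obtain ⟨j, hj, rfl⟩ := Finset.mem_image.1 ha
        simpa using h0 j hj
      · rw [Finset.card_image_of_injOn hinj, hs, Finset.card_erase_of_mem (Finset.mem_univ _),
          Finset.card_univ, ZMod.card]
    rw [← this, Finset.prod_image hinj]
  rw [key hs hinj h0, ← ZMod.prod_Ico_one_prime p, key]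
  · simp
  · intro a ha b hb h
    simp only [Finset.coe_Ico, Set.mem_Ico] at ha hb
    exact CharP.natCast_injOn_Iio (ZMod p) p (by simpa using ha.2) (by simpa using hb.2) h
  · intro a ha h
    rw [Finset.mem_Ico] at ha
    rw [ZMod.natCast_eq_zero_iff] at h
    exact absurd (Nat.le_of_dvd (by omega) h) (by omega)

/-- Both blocks around the factor `p`, namely `1..p-1` and `p+1..2p-1`, have product `-1` mod `p`.
-/
theorem factorial_two_mul_sub_one (p : ℕ) [hp : Fact p.Prime] :
    ∃ N : ℕ, (2 * p - 1).factorial = p * N ∧ (N : ZMod p) = 1 := by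
  have hp1 := hp.out.one_lt
  refine ⟨(p - 1).factorial * (p + 1).ascFactorial (p - 1), ?_, ?_⟩
  · rw [← mul_assoc, Nat.mul_factorial_pred hp.out.ne_zero, Nat.factorial_mul_ascFactorial]
    congr 1
    omega
  · have h : ∏ i ∈ Finset.range (p - 1), ((p + 1 + i : ℕ) : ZMod p) = -1 := by
      apply ZMod.prod_eq_neg_one_of_injOn (by simp)
      · intro a ha b hb h
        simp only [Finset.coe_range, Set.mem_Iio] at ha hb
        simp only [Nat.cast_add, add_right_inj] at h
        exact CharP.natCast_injOn_Iio (ZMod p) p (by simp; omega) (by simp; omega) h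
      · intro a ha h
        rw [Finset.mem_range] at ha
        rw [add_assoc, Nat.cast_add, CharP.cast_eq_zero, zero_add, ZMod.natCast_eq_zero_iff] at h
        exact absurd (Nat.le_of_dvd (by omega) h) (by omega)
    rw [Nat.cast_mul, ZMod.wilsons_lemma, Nat.ascFactorial_eq_prod_range, Nat.cast_prod, h]
    norm_num

/-- `(2k+1)!` divides `(2p-1)!`, which contains only one factor `p`. -/
theorem exists_padicInt_eq_div_factorial {p : ℕ} [Fact p.Prime] {k : ℕ} (hk : k < p) :
    ∃ u : ℤ_[p], (p : ℚ_[p]) / ((2 * k + 1).factorial : ℚ_[p]) = u := by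
  obtain ⟨N, hN, hN1⟩ := factorial_two_mul_sub_one p
  obtain ⟨v, hv⟩ := PadicInt.exists_mul_eq_one_of_toZMod_ne_zero (z := (N : ℤ_[p]))
    (by rw [map_natCast, hN1]; exact one_ne_zero)
  obtain ⟨d, hd⟩ := Nat.factorial_dvd_factorial (show 2 * k + 1 ≤ 2 * p - 1 by omega)
  refine ⟨d * v, ?_⟩
  rw [div_eq_iff (by exact_mod_cast Nat.factorial_ne_zero _)]
  have hv' : (N : ℚ_[p]) * (v : ℚ_[p]) = 1 := by
    exact_mod_cast congrArg (fun z : ℤ_[p] => (z : ℚ_[p])) hv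
  have hd' : ((2 * k + 1).factorial : ℚ_[p]) * d = p * N := by
    exact_mod_cast hd.symm.trans hN
  push_cast
  linear_combination (-(p : ℚ_[p])) * hv' - (v : ℚ_[p]) * hd'

/-! ### Congruences mod `p^2`: the midpoint and the recurrence -/

/-- Near the centre of symmetry `-1/2`, the sum `sineSum p` is linear modulo `p ^ 2`. -/
theorem sineSum_half_modEq {p : ℕ} [Fact p.Prime] {m : ℕ} (hm : 2 * m + 1 = p) (t : ℤ_[p]) :
    ∃ c : ℤ_[p], sineSum p ((m : ℚ_[p]) + p * t) - (-1) ^ m * (2 * t + 1) = p ^ 2 * c := by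
  have hterm (k : ℕ) (hk : k ∈ Finset.range p) : ∃ c : ℤ_[p],
      (p : ℚ_[p]) * ((-4) ^ k * (∏ j ∈ Finset.range k, ((m : ℚ_[p]) + p * t - j) *
        ((m : ℚ_[p]) + p * t + j + 1)) / ((2 * k + 1).factorial : ℚ_[p])) -
      p * ((-4) ^ k * (∏ j ∈ Finset.range k, ((m : ℚ_[p]) - j) *
        ((m : ℚ_[p]) + j + 1)) / ((2 * k + 1).factorial : ℚ_[p])) = p ^ 2 * c := by
    obtain ⟨u, hu⟩ := exists_padicInt_eq_div_factorial (Finset.mem_range.1 hk)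
    have hdvd : (p : ℤ_[p]) ^ 2 ∣
        ∏ j ∈ Finset.range k, ((m : ℤ_[p]) + p * t - j) * ((m : ℤ_[p]) + p * t + j + 1) -
        ∏ j ∈ Finset.range k, ((m : ℤ_[p]) - j) * ((m : ℤ_[p]) + j + 1) := by
      rw [← Ideal.mem_span_singleton, ← Ideal.Quotient.eq, map_prod, map_prod]
      refine Finset.prod_congr rfl fun j _ => ?_
      rw [Ideal.Quotient.eq, Ideal.mem_span_singleton]
      -- Each factor is `x(x+1) - j(j+1)`, and since `2m+1 = p`, replacing `m` by `m + pt` changes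
      -- `x(x+1)` by exactly `p^2 t(t+1)`.
      refine ⟨t * (t + 1), ?_⟩
      have : (2 * m + 1 : ℤ_[p]) = p := by exact_mod_cast congrArg (Nat.cast (R := ℤ_[p])) hm
      linear_combination ((p : ℤ_[p]) * t) * this
    obtain ⟨c, hc⟩ := hdvd
    have hc' := congrArg (fun z : ℤ_[p] => (z : ℚ_[p])) hc
    push_cast [PadicInt.coe_finsetProd] at hc'
    refine ⟨(-4) ^ k * u * c, ?_⟩
    rw [show ((((-4) ^ k * u * c : ℤ_[p])) : ℚ_[p]) = (-4) ^ k * u * c by push_cast; rfl, ← hu]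
    rw [mul_div_assoc', mul_div_assoc', ← sub_div, mul_div_assoc']
    linear_combination ((p : ℚ_[p]) * (-4) ^ k / ((2 * k + 1).factorial : ℚ_[p])) * hc'
  choose! c hc using hterm
  have hsum := Finset.sum_congr rfl hc
  rw [Finset.sum_sub_distrib, ← Finset.mul_sum, ← Finset.mul_sum, ← Finset.mul_sum] at hsum
  have hone : sineSum p (m : ℚ_[p]) = (-1) ^ m := sineSum_natCast (by omega)
  have hm' : (2 * m + 1 : ℚ_[p]) = p := by exact_mod_cast congrArg (Nat.cast (R := ℚ_[p])) hm
  refine ⟨(2 * t + 1) * ∑ k ∈ Finset.range p, c k, ?_⟩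
  rw [← hone]
  unfold sineSum
  push_cast [PadicInt.coe_sum]
  rw [show 2 * ((m : ℚ_[p]) + p * t) + 1 = p * (2 * t + 1) by linear_combination hm', hm']
  linear_combination (2 * (t : ℚ_[p]) + 1) * hsum

/-- The left side is the product of all `x - j` and `x + j` with `0 ≤ j < p`. Each family has one
factor divisible by `p`, namely `x - r = pt` and `x + (p-r) = p(t+1)`; the others multiply to `-1`
mod `p`. -/
theorem mul_prod_sq_sub_sq {p : ℕ} [hp : Fact p.Prime] {r : ℕ} (hr0 : r ≠ 0) (hr : r < p)
    (t : ℤ_[p]) : ∃ B : ℤ_[p], PadicInt.toZMod B = 1 ∧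
      ((r : ℤ_[p]) + p * t) * (((r : ℤ_[p]) + p * t) *
        ∏ j ∈ Finset.range (p - 1), (((r : ℤ_[p]) + p * t) ^ 2 - (j + 1) ^ 2)) =
      p ^ 2 * (t * (t + 1)) * B := by
  set x : ℤ_[p] := (r : ℤ_[p]) + p * t with hx
  have hp1 := hp.out.one_lt
  have hxz : PadicInt.toZMod x = (r : ZMod p) := by simp [hx]
  refine ⟨(∏ j ∈ (Finset.range p).erase r, (x - j)) *
    ∏ j ∈ (Finset.range p).erase (p - r), (x + j), ?_, ?_⟩
  · rw [map_mul, map_prod, map_prod, ZMod.prod_eq_neg_one_of_injOn,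
      ZMod.prod_eq_neg_one_of_injOn]
    · norm_num
    · rw [Finset.card_erase_of_mem (Finset.mem_range.2 (by omega)), Finset.card_range]
    · intro a ha b hb h
      simp only [Finset.coe_erase, Finset.coe_range, Set.mem_sdiff, Set.mem_Iio] at ha hb
      simp only [map_add, map_natCast, add_right_inj] at h
      exact CharP.natCast_injOn_Iio (ZMod p) p (by simpa using ha.1) (by simpa using hb.1) h
    · intro a ha h
      simp only [Finset.mem_erase, Finset.mem_range] at ha
      rw [map_add, hxz, map_natCast, ← Nat.cast_add, ZMod.natCast_eq_zero_iff] at h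
      obtain ⟨c, hc⟩ := h
      have h1 : c < 2 := by
        by_contra hc2
        have := Nat.mul_le_mul_left p (not_lt.1 hc2)
        omega
      interval_cases c <;> omega
    · rw [Finset.card_erase_of_mem (Finset.mem_range.2 hr), Finset.card_range]
    · intro a ha b hb h
      simp only [Finset.coe_erase, Finset.coe_range, Set.mem_sdiff, Set.mem_Iio] at ha hb
      simp only [map_sub, map_natCast, sub_right_inj] at h
      exact CharP.natCast_injOn_Iio (ZMod p) p (by simpa using ha.1) (by simpa using hb.1) h
    · intro a ha h
      simp only [Finset.mem_erase, Finset.mem_range] at ha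
      rw [map_sub, hxz, map_natCast, sub_eq_zero] at h
      exact ha.1 (CharP.natCast_injOn_Iio (ZMod p) p (by simpa using hr)
        (by simpa using ha.2) h).symm
  · have h1 := Finset.mul_prod_erase (Finset.range p) (fun j : ℕ => x - (j : ℤ_[p]))
      (Finset.mem_range.2 hr)
    have h2 := Finset.mul_prod_erase (Finset.range p) (fun j : ℕ => x + (j : ℤ_[p]))
      (Finset.mem_range.2 (show p - r < p by omega))
    have h3 : ∏ j ∈ Finset.range p, (x - (j : ℤ_[p])) =
        (∏ j ∈ Finset.range (p - 1), (x - (j + 1))) * x := by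
      obtain ⟨n, hn⟩ : ∃ n, p - 1 = n := ⟨_, rfl⟩
      rw [show Finset.range p = Finset.range (n + 1) by congr 1; omega, hn,
        Finset.prod_range_succ']
      simp
    have h4 : ∏ j ∈ Finset.range p, (x + (j : ℤ_[p])) =
        (∏ j ∈ Finset.range (p - 1), (x + (j + 1))) * x := by
      obtain ⟨n, hn⟩ : ∃ n, p - 1 = n := ⟨_, rfl⟩
      rw [show Finset.range p = Finset.range (n + 1) by congr 1; omega, hn,
        Finset.prod_range_succ']
      simp
    have h5 : ∏ j ∈ Finset.range (p - 1), (x ^ 2 - ((j : ℤ_[p]) + 1) ^ 2) =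
        (∏ j ∈ Finset.range (p - 1), (x - (j + 1))) *
          ∏ j ∈ Finset.range (p - 1), (x + (j + 1)) := by
      rw [← Finset.prod_mul_distrib]
      exact Finset.prod_congr rfl fun j _ => by ring
    have hA : x - (r : ℤ_[p]) = p * t := by rw [hx]; ring
    have hB : x + ((p - r : ℕ) : ℤ_[p]) = p * (t + 1) := by
      rw [hx, Nat.cast_sub hr.le]; ring
    rw [h3, hA] at h1
    rw [h4, hB] at h2
    rw [h5]
    calc _ = ((∏ j ∈ Finset.range (p - 1), (x - ((j : ℤ_[p]) + 1))) * x) *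
          ((∏ j ∈ Finset.range (p - 1), (x + ((j : ℤ_[p]) + 1))) * x) := by ring
      _ = _ := by rw [← h1, ← h2]; ring

/-- The denominator `(2p-1)!` cancels one of the two factors `p` in the numerator. Modulo `p`,
Fermat turns the remaining `1/x` into `x^(p-2)` and `(-4)^(p-1)` into 1. -/
theorem sineSum_add_sineSum_sub_one_modEq {p : ℕ} [hp : Fact p.Prime] (hp2 : p ≠ 2) {r : ℕ}
    (hr0 : r ≠ 0) (hr : r < p) (t : ℤ_[p]) :
    ∃ c : ℤ_[p], sineSum p ((r : ℚ_[p]) + p * t) + sineSum p ((r : ℚ_[p]) + p * t - 1) -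
      4 * p * (t * (t + 1)) * ((r : ℚ_[p]) + p * t) ^ (p - 2) = p ^ 2 * c := by
  have hp1 := hp.out.one_lt
  obtain ⟨B, hB1, hB⟩ := mul_prod_sq_sub_sq hr0 hr t
  obtain ⟨N, hN, hN1⟩ := factorial_two_mul_sub_one p
  have hr' : (r : ZMod p) ≠ 0 := by
    rw [Ne, ZMod.natCast_eq_zero_iff]
    exact fun h => absurd (Nat.le_of_dvd (by omega) h) (by omega)
  obtain ⟨v, hv⟩ := PadicInt.exists_mul_eq_one_of_toZMod_ne_zero (z := (N : ℤ_[p]))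
    (by rw [map_natCast, hN1]; exact one_ne_zero)
  obtain ⟨y, hy⟩ := PadicInt.exists_mul_eq_one_of_toZMod_ne_zero
    (z := (r : ℤ_[p]) + (p : ℤ_[p]) * t)
    (by simpa using hr')
  have hdvd : (p : ℤ_[p]) ∣
      (-4) ^ (p - 1) * 4 * y * B * v - 4 * ((r : ℤ_[p]) + (p : ℤ_[p]) * t) ^ (p - 2) := by
    rw [← PadicInt.toZMod_eq_zero_iff_dvd]
    have hv' := congrArg PadicInt.toZMod hv
    have hy' := congrArg PadicInt.toZMod hy
    simp only [map_mul, map_add, map_natCast, map_one, hN1, one_mul, CharP.cast_eq_zero, zero_mul,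
      add_zero] at hv' hy'
    have h4 : (-4 : ZMod p) ^ (p - 1) = 1 := by
      apply ZMod.pow_card_sub_one_eq_one
      rw [neg_ne_zero, show (4 : ZMod p) = 2 * 2 by norm_num]
      have : (2 : ZMod p) ≠ 0 := Ring.two_ne_zero (by rwa [ZMod.ringChar_zmod_n])
      exact mul_ne_zero this this
    have hrp : (r : ZMod p) ^ (p - 2) * r = 1 := by
      rw [← pow_succ, show p - 2 + 1 = p - 1 by omega, ZMod.pow_card_sub_one_eq_one hr']
    simp only [map_sub, map_mul, map_add, map_pow, map_neg, map_natCast, map_ofNat, hB1, hv', h4,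
      CharP.cast_eq_zero, zero_mul, add_zero]
    linear_combination (-4 * PadicInt.toZMod y) * hrp + 4 * (r : ZMod p) ^ (p - 2) * hy'
  obtain ⟨c, hc⟩ := hdvd
  refine ⟨t * (t + 1) * c, ?_⟩
  have hrec := sineSum_add_sineSum_sub_one (p - 1) ((r : ℚ_[p]) + p * t)
  rw [show p - 1 + 1 = p by omega, show 2 * (p - 1) + 1 = 2 * p - 1 by omega, hN] at hrec
  have hB' := congrArg (fun z : ℤ_[p] => (z : ℚ_[p])) hB
  have hc' := congrArg (fun z : ℤ_[p] => (z : ℚ_[p])) hc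
  have hv' := congrArg (fun z : ℤ_[p] => (z : ℚ_[p])) hv
  have hy' := congrArg (fun z : ℤ_[p] => (z : ℚ_[p])) hy
  push_cast [PadicInt.coe_finsetProd] at hB' hc' hv' hy'
  rw [hrec]
  have hp0 : (p : ℚ_[p]) ≠ 0 := by exact_mod_cast hp.out.ne_zero
  have hN0 : (N : ℚ_[p]) ≠ 0 := left_ne_zero_of_mul_eq_one hv'
  set x : ℚ_[p] := (r : ℚ_[p]) + p * t
  set A : ℚ_[p] := ∏ j ∈ Finset.range (p - 1), (x ^ 2 - ((j : ℚ_[p]) + 1) ^ 2)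
  have hA : x * A = p ^ 2 * (t * (t + 1)) * B * y := by
    linear_combination (-(x * A)) * hy' + (y : ℚ_[p]) * hB'
  have hfrac : (-4) ^ (p - 1) * (4 * x * A) / ((p * N : ℕ) : ℚ_[p]) =
      (-4) ^ (p - 1) * 4 * (p * (t * (t + 1)) * B * y) * v := by
    rw [div_eq_iff (by exact_mod_cast mul_ne_zero hp0 hN0)]
    push_cast
    linear_combination (-4) ^ (p - 1) * 4 * hA -
      (-4) ^ (p - 1) * 4 * (p ^ 2 * (t * (t + 1)) * B * y) * hv'
  rw [hfrac]
  push_cast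
  linear_combination (p : ℚ_[p]) * (t * (t + 1)) * hc'

/-! ### Propagation from the midpoint and conclusion -/

open Polynomial in
/-- The congruence at all points `r + p t` with `t` fixed and `0 ≤ r < p`. -/
theorem sineSum_modEq {p : ℕ} [Fact p.Prime] (hp : p ≠ 2) {q : ℤ_[p][X]}
    (hq : q.comp (X + 1) + q = 2 * X ^ (p - 2)) (t : ℤ_[p]) {r : ℕ} (hr : r < p) :
    ∃ c : ℤ_[p], sineSum p ((r : ℚ_[p]) + p * t) - ((-1) ^ r * (2 * t + 1) -
      2 * p * t * (t + 1) * (q.eval (-((r : ℤ_[p]) + p * t)) : ℤ_[p])) = p ^ 2 * c := by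
  have hprime : p.Prime := Fact.out
  have hodd : Odd p := hprime.odd_of_ne_two hp
  have hp2 : 2 < p := lt_of_le_of_ne hprime.two_le (Ne.symm hp)
  have hodd2 : Odd (p - 2) := Nat.Odd.sub_even hp2.le hodd even_two
  obtain ⟨m, hm⟩ := hodd
  set D : ℕ → ℚ_[p] := fun r => sineSum p ((r : ℚ_[p]) + p * t) - ((-1) ^ r * (2 * t + 1) -
      2 * p * t * (t + 1) * (q.eval (-((r : ℤ_[p]) + p * t)) : ℤ_[p])) with hD
  have hmid : ∃ c : ℤ_[p], D m = p ^ 2 * c := by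
    obtain ⟨c, hc⟩ := sineSum_half_modEq hm.symm t
    have hmp : (2 * m + 1 : ZMod p) = 0 := by
      have := congrArg (Nat.cast (R := ZMod p)) hm
      rw [CharP.cast_eq_zero] at this
      exact_mod_cast this.symm
    -- Since `2m+1 = p`, the residue of `-m` is `1/2`.
    have hz : (q.map PadicInt.toZMod).eval (-(m : ZMod p)) = 0 := by
      apply eval_eq_zero_of_comp_X_add_one hp hodd2
      · simpa [Polynomial.map_comp] using congrArg (Polynomial.map PadicInt.toZMod) hq
      · linear_combination -hmp
    have hdvd : (p : ℤ_[p]) ∣ q.eval (-((m : ℤ_[p]) + p * t)) := by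
      rw [← PadicInt.toZMod_eq_zero_iff_dvd, ← eval₂_at_apply, ← eval_map]
      simpa using hz
    obtain ⟨d, hd⟩ := hdvd
    refine ⟨c + 2 * t * (t + 1) * d, ?_⟩
    simp only [hD]
    rw [hd]
    push_cast
    linear_combination hc
  have hstep (r : ℕ) (hr : r + 1 < p) : ∃ c : ℤ_[p], D (r + 1) + D r = p ^ 2 * c := by
    obtain ⟨c, hc⟩ := sineSum_add_sineSum_sub_one_modEq hp (Nat.succ_ne_zero r) hr t
    have he := congrArg (fun z : ℤ_[p] => (z : ℚ_[p]))
      (congrArg (eval (-(((r + 1 : ℕ) : ℤ_[p]) + p * t))) hq)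
    simp only [eval_add, eval_comp, eval_X, eval_one, eval_mul, eval_pow, eval_ofNat] at he
    rw [hodd2.neg_pow, show -(((r + 1 : ℕ) : ℤ_[p]) + p * t) + 1 = -((r : ℤ_[p]) + p * t) by
      push_cast; ring] at he
    rw [show ((r + 1 : ℕ) : ℚ_[p]) + p * t - 1 = r + p * t by push_cast; ring] at hc
    refine ⟨c, ?_⟩
    simp only [hD]
    rw [PadicInt.coe_add, PadicInt.coe_mul, PadicInt.coe_neg, PadicInt.coe_pow, PadicInt.coe_add,
      PadicInt.coe_mul, PadicInt.coe_natCast, PadicInt.coe_natCast,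
      show (((2 : ℤ_[p])) : ℚ_[p]) = 2 from rfl] at he
    rw [pow_succ]
    linear_combination hc + 2 * p * t * (t + 1) * he
  have hzero (r : ℕ) (hr : r < p) : ∃ c : ℤ_[p], D r - (-1) ^ r * D 0 = p ^ 2 * c := by
    induction r with
    | zero => exact ⟨0, by simp⟩
    | succ r ih =>
      obtain ⟨c, hc⟩ := ih (by omega)
      obtain ⟨d, hd⟩ := hstep r hr
      refine ⟨d - c, ?_⟩
      push_cast
      rw [pow_succ]
      linear_combination hd - hc
  obtain ⟨a, ha⟩ := hmid
  obtain ⟨b, hb⟩ := hzero m (by omega)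
  obtain ⟨c, hc⟩ := hzero r hr
  have hsq : ((-1 : ℚ_[p]) ^ m) * (-1) ^ m = 1 := by rw [← mul_pow]; norm_num
  -- The error alternates in sign mod `p^2`, so `D r` is compared with `D m` through `D 0`.
  refine ⟨c + (-1) ^ r * (-1) ^ m * (a - b), ?_⟩
  change D r = _
  push_cast
  linear_combination hc + (-1) ^ r * (-1) ^ m * (ha - hb) - (-1) ^ r * D 0 * hsq

theorem theorem1p1 (p : ℕ) [Fact p.Prime] (hp : p ≠ 2) (x t : ℤ_[p])
    (hxt : x = (x.zmodRepr : ℤ_[p]) + (p : ℤ_[p]) * t) :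
    ∃ c : ℤ_[p],
      (2 * (x : ℚ_[p]) + 1) *
          ∑ k ∈ Finset.range p,
            ((Ring.choose x k : ℤ_[p]) : ℚ_[p]) * ((Ring.choose (x + (k : ℤ_[p])) k : ℤ_[p]) : ℚ_[p]) *
                (-4 : ℚ_[p]) ^ k /
              ((2 * (k : ℚ_[p]) + 1) * (Nat.choose (2 * k) k : ℚ_[p])) -
        ((-1 : ℚ_[p]) ^ x.zmodRepr * (2 * (t : ℚ_[p]) + 1) -
          2 * (p : ℚ_[p]) * (t : ℚ_[p]) * ((t : ℚ_[p]) + 1) *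
            Polynomial.aeval (-(x : ℚ_[p])) (eulerPolynomial (p - 2))) =
      (p : ℚ_[p]) ^ 2 * (c : ℚ_[p]) := by

  obtain ⟨q, hq, hqE⟩ := exists_padicInt_eulerPolynomial hp (p - 2)
  have hx : (x : ℚ_[p]) = (x.zmodRepr : ℚ_[p]) + p * t := by
    have := congrArg (fun z : ℤ_[p] => (z : ℚ_[p])) hxt
    push_cast at this
    exact this
  obtain ⟨c, hc⟩ := sineSum_modEq hp hq t x.zmodRepr_lt_p
  refine ⟨c, ?_⟩
  rw [sum_choose_mul_choose_eq_sineSum, ← PadicInt.coe_neg, hqE]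
  rw [← hx, ← hxt] at hc
  exact hc
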